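/- For $n\ge 1$ put $[n]_{p,q}=p^{n-1}+p^{n-2}q+\cdots+pq^{n-2}+q^{n-1}$, and $[0]_{p,q}=0$. Define polynomials $\hat A_n(t,p,q)\in\mathbb Z[p,q][t]$ by the formal power series expansion $$\sum_{n\ge 0}\hat A_n(t,p,q)x^n=\cfrac{1}{1-b_0x-\cfrac{\lambda_1x^2}{1-b_1x-\cfrac{\lambda_2x^2}{1-b_2x-\cdots}}},\qquad b_n=(1+t)[n+1]_{p,q},\quad \lambda_n=tq[n]_{p,q}^2 .$$ For a permutation $\sigma=\sigma_1\cdots\sigma_n$ of $[n]=\{1,\dots,n\}$ let - $\mathrm{cros}(\sigma)=|\{(i,j)\in[n]^2: i<j\le\sigma_i<\sigma_j\text{ or } i>j>\sigma_i>\sigma_j\}|$ (crossings); - $\mathrm{nest}(\sigma)=|\{(i,j)\in[n]^2: i<j\le\sigma_j<\sigma_i\text{ or } i>j>\sigma_j>\sigma_i\}|$ (nestings); - $\mathrm{drop}(\sigma)=|\{i:\sigma_i<i\}|$ and $\mathrm{cdfall}(\sigma)=|\{i:\sigma^{-1}(i)>i>\sigma(i)\}|$ (drops, cycle double falls); - $\mathrm{des}(\sigma)=|\{i\in[n-1]:\sigma_i>\sigma_{i+1}\}|$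 and $\mathrm{dd}(\sigma)=|\{2\le i\le n-1:\sigma_{i-1}>\sigma_i>\sigma_{i+1}\}|$ (descents, double descents; a first letter $\sigma_1>\sigma_2$ is not counted as a double descent); - $(2\text{-}31)\sigma=|\{(i,j): 1\le i<j\le n-1,\ \sigma_{j+1}<\sigma_i<\sigma_j\}|$ and $(31\text{-}2)\sigma=|\{(i,j): 2\le i<j\le n,\ \sigma_i<\sigma_j<\sigma_{i-1}\}|$. **Theorem.** Let $n\ge 0$. 1. $\hat A_n(t,p,q)$ is a $(p,q)$-analog of the binomial-Eulerian polynomial: $\hat A_n(t,1,1)=1+t\sum_{m=1}^n\binom nm A_m(t)$, where $A_m(t)=\sum_{\pi\in\mathfrak S_m}t^{\mathrm{des}(\pi)}$ is the Eulerian polynomial. 2. $\hat A_n(t,p,q)$ has degree $n$ in $t$ and is $\gamma$-positive: $$\hat A_n(t,p,q)=\sum_{k=0}^{\lfloor n/2\rfloor}\hat\gamma_{n,k}(p,q)\,t^k(1+t)^{n-2k},$$ where the $\hat\gamma_{n,k}(p,q)$ are polynomials in $p,q$ with non-negative integer coefficients, given by $$\hat\gamma_{n,k}(p,q)=\sum_{\substack{\sigma\in\mathfrak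 S_n\\ \mathrm{cdfall}(\sigma)=0,\ \mathrm{drop}(\sigma)=k}}p^{\mathrm{nest}(\sigma)}q^{\mathrm{cros}(\sigma)+k} =\sum_{\substack{\sigma\in\mathfrak S_n\\ \mathrm{dd}(\sigma)=0,\ \mathrm{des}(\sigma)=k}}p^{(2\text{-}31)\sigma}q^{(31\text{-}2)\sigma+k}\qquad(0\le k\le\lfloor n/2\rfloor).$$ -/

import Mathlib

open Polynomial

namespace BinomialEulerian

/-! ### Formal Jacobi continued fractions -/

section JFraction

variable {R : Type*} [CommRing R]

/-- `jConvergent b l N i` is the `N`-th convergent of the J-fraction that starts at level `i`,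
`1 / (1 - b i x - l (i+1) x ^ 2 / (1 - b (i+1) x - l (i+2) x ^ 2 / ...))`,
with `N` levels kept; `N = 0` gives `0`.  Each denominator has constant term `1`, and
`invOfUnit _ 1` is then its inverse as a formal power series. -/
noncomputable def jConvergent (b l : ℕ → R) : ℕ → ℕ → PowerSeries R
  | 0, _ => 0
  | N + 1, i => PowerSeries.invOfUnit
      (1 - PowerSeries.C (b i) * PowerSeries.X
        - PowerSeries.C (l (i + 1)) * PowerSeries.X ^ 2 * jConvergent b l N (i + 1)) 1

/-- The infinite J-fraction
`1 / (1 - b 0 x - l 1 x ^ 2 / (1 - b 1 x - l 2 x ^ 2 / ...))`, the coefficientwise limit of its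
convergents (see `coeff_jConvergent`). -/
noncomputable def jFraction (b l : ℕ → R) : PowerSeries R :=
  PowerSeries.mk fun n => PowerSeries.coeff n (jConvergent b l (n + 1) 0)

/-- The denominators are inverted by the convergents. -/
theorem jConvergent_mul (b l : ℕ → R) (N i : ℕ) :
    (1 - PowerSeries.C (b i) * PowerSeries.X
      - PowerSeries.C (l (i + 1)) * PowerSeries.X ^ 2 * jConvergent b l N (i + 1))
      * jConvergent b l (N + 1) i = 1 := by
  rw [jConvergent]
  exact PowerSeries.mul_invOfUnit _ 1 (by simp)

theorem jConvergent_congr (b l : ℕ → R) (N : ℕ) : ∀ (M i : ℕ), N ≤ M →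
    (PowerSeries.X : PowerSeries R) ^ (2 * N) ∣ jConvergent b l M i - jConvergent b l N i := by
  induction N with
  | zero => intro M i _; simp
  | succ N ih =>
    intro M i h
    obtain ⟨M, rfl⟩ : ∃ M', M = M' + 1 := ⟨M - 1, by omega⟩
    obtain ⟨c, hc⟩ := ih M (i + 1) (by omega)
    have h1 := jConvergent_mul b l M i
    have h2 := jConvergent_mul b l N i
    refine ⟨PowerSeries.C (l (i + 1)) * c * jConvergent b l (M + 1) i
      * jConvergent b l (N + 1) i, ?_⟩
    linear_combination (jConvergent b l (N + 1) i) * h1 - (jConvergent b l (M + 1) i) * h2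
      + (PowerSeries.C (l (i + 1)) * PowerSeries.X ^ 2 * jConvergent b l (M + 1) i
        * jConvergent b l (N + 1) i) * hc

/-- The coefficient of `x ^ n` is the same in all convergents with more than `n` levels: the
convergents converge to `jFraction b l`. -/
theorem coeff_jConvergent (b l : ℕ → R) {n N : ℕ} (h : n < N) :
    PowerSeries.coeff n (jConvergent b l N 0) = PowerSeries.coeff n (jFraction b l) := by
  rw [jFraction, PowerSeries.coeff_mk, ← sub_eq_zero, ← map_sub]
  exact PowerSeries.X_pow_dvd_iff.mp (jConvergent_congr b l (n + 1) N 0 h) n (by omega)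

end JFraction

/-! ### The polynomials -/

/-- The ring `ℤ[p, q]`. -/
abbrev PQ : Type := MvPolynomial (Fin 2) ℤ

/-- The indeterminate `p`. -/
noncomputable def pVar : PQ := MvPolynomial.X 0

/-- The indeterminate `q`. -/
noncomputable def qVar : PQ := MvPolynomial.X 1

/-- `[n]_{p,q} = p ^ (n-1) + p ^ (n-2) q + ... + q ^ (n-1)`. -/
noncomputable def pqNumber (n : ℕ) : PQ :=
  ∑ i ∈ Finset.range n, pVar ^ (n - 1 - i) * qVar ^ i

/-- The polynomial `Â_n(t, p, q)` in `ℤ[p, q][t]`: the coefficient of `x ^ n` in the J-fraction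
with `b_n = (1 + t) [n+1]_{p,q}` and `λ_n = t q [n]_{p,q} ^ 2`. -/
noncomputable def hatA (n : ℕ) : PQ[X] :=
  PowerSeries.coeff n (jFraction
    (fun m => (1 + X) * C (pqNumber (m + 1)))
    (fun m => X * C (qVar * pqNumber m ^ 2)))

/-! ### Permutation statistics

A permutation of `{1, ..., n}` is `σ : Equiv.Perm (Fin n)`; positions and values are both
shifted by one, which affects none of the comparisons below. -/

section Statistics

variable {n : ℕ}

/-- The number of crossings. -/
def cros (σ : Equiv.Perm (Fin n)) : ℕ :=
  (Finset.univ.filter fun x : Fin n × Fin n =>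
    (x.1 < x.2 ∧ x.2 ≤ σ x.1 ∧ σ x.1 < σ x.2) ∨
    (x.1 > x.2 ∧ x.2 > σ x.1 ∧ σ x.1 > σ x.2)).card

/-- The number of nestings. -/
def nest (σ : Equiv.Perm (Fin n)) : ℕ :=
  (Finset.univ.filter fun x : Fin n × Fin n =>
    (x.1 < x.2 ∧ x.2 ≤ σ x.2 ∧ σ x.2 < σ x.1) ∨
    (x.1 > x.2 ∧ x.2 > σ x.2 ∧ σ x.2 > σ x.1)).card

/-- The number of drops. -/
def drop (σ : Equiv.Perm (Fin n)) : ℕ :=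
  (Finset.univ.filter fun i : Fin n => σ i < i).card

/-- The number of cycle double falls. -/
def cdfall (σ : Equiv.Perm (Fin n)) : ℕ :=
  (Finset.univ.filter fun i : Fin n => σ⁻¹ i > i ∧ i > σ i).card

/-- The number of descents. -/
def des (σ : Equiv.Perm (Fin n)) : ℕ :=
  (Finset.univ.filter fun i : Fin n =>
    ∃ j : Fin n, (j : ℕ) = i + 1 ∧ σ i > σ j).card

/-- The number of (non-initial) double descents: positions `i` with `σ_{i-1} > σ_i > σ_{i+1}`,
where `σ_{n+1} = +∞` and `i` is not the first position. -/
def dd (σ : Equiv.Perm (Fin n)) : ℕ :=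
  (Finset.univ.filter fun i : Fin n =>
    ∃ h j : Fin n, (i : ℕ) = h + 1 ∧ (j : ℕ) = i + 1 ∧ σ h > σ i ∧ σ i > σ j).card

/-- The number of occurrences of the pattern 2-31: pairs `i < j` with
`σ_{j+1} < σ_i < σ_j`. -/
def pat2_31 (σ : Equiv.Perm (Fin n)) : ℕ :=
  (Finset.univ.filter fun x : Fin n × Fin n => x.1 < x.2 ∧
    ∃ k : Fin n, (k : ℕ) = x.2 + 1 ∧ σ k < σ x.1 ∧ σ x.1 < σ x.2).card

/-- The number of occurrences of the pattern 31-2: pairs `i < j` with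
`σ_i < σ_j < σ_{i-1}`. -/
def pat31_2 (σ : Equiv.Perm (Fin n)) : ℕ :=
  (Finset.univ.filter fun x : Fin n × Fin n => x.1 < x.2 ∧
    ∃ h : Fin n, (x.1 : ℕ) = h + 1 ∧ σ x.1 < σ x.2 ∧ σ x.2 < σ h).card

end Statistics

/-- The permutations of `n` letters with no cycle double falls and `k` drops. -/
def hatGammaSet (n k : ℕ) : Finset (Equiv.Perm (Fin n)) :=
  Finset.univ.filter fun σ => cdfall σ = 0 ∧ drop σ = k

/-- The permutations of `n` letters with no double descents and `k` descents. -/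
def tildeGammaSet (n k : ℕ) : Finset (Equiv.Perm (Fin n)) :=
  Finset.univ.filter fun σ => dd σ = 0 ∧ des σ = k

/-- `γ̂_{n,k}(p, q)`. -/
noncomputable def hatGamma (n k : ℕ) : PQ :=
  ∑ σ ∈ hatGammaSet n k, pVar ^ nest σ * qVar ^ (cros σ + k)

/-! ### Eulerian and binomial-Eulerian polynomials -/

/-- The Eulerian polynomial `A_n(t)`. -/
noncomputable def eulerian (n : ℕ) : ℤ[X] :=
  ∑ σ : Equiv.Perm (Fin n), X ^ des σ

/-- The binomial-Eulerian polynomial `Ã_n(t)`. -/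
noncomputable def binomialEulerian (n : ℕ) : ℤ[X] :=
  1 + X * ∑ m ∈ Finset.Icc 1 n, (n.choose m : ℤ[X]) * eulerian m

/-- The specialization `p = q = 1` of a polynomial in `ℤ[p, q][t]`. -/
noncomputable def specializeOne (f : PQ[X]) : ℤ[X] :=
  f.map (MvPolynomial.eval fun _ => (1 : ℤ))

end BinomialEulerian

open BinomialEulerian

/-! By Flajolet's theorem a J-fraction enumerates weighted Motzkin paths. Since `[r+1]_{p,q}` is the
sum of `p^j q^i` over `i + j = r`, the paths needed here unfold into Laguerre histories, whose steps
carry two counters with prescribed sum. There are `n! * choose n h` histories of length `n` ending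
at height `h` (`card_histories`), hence `n!` that return to `0`. An injective coding of permutations
by such histories is therefore bijective, and no inverse map has to be built.

Two codings are used. `cycleStep` scans the cut between small and large points and records drops,
crossings and nestings; `linearStep` scans the cut between small and large letters and records
descents, 31-2 and 2-31. So `sum_cycle` and `sum_linear` express the same J-fraction, with free
weights `a`, `d`, `v` for steps that neither open nor close, do both, or only open.

Specializations give the theorem. With `a = 1 + t`, `d = 0`, `v = tq` the cyclic sum is the
γ-expansion. With `a = 1`, `d = 0`, `v = qt`, comparing coefficients of `t^k` in both sums
identifies the two formulas for `γ̂`. At `p = q = 1`, writing `(1 + t)(h + 1) = 1 + (t(h + 1) + h)`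
exhibits `Â_n` as the binomial transform of the sequence with `a = v = t`, `d = 1`, whose terms are
`∑ t^(n - des)`, that is `t A_n(t)` for `n ≥ 1`. -/

namespace BinomialEulerian

/-! ### Weighted Motzkin paths and Jacobi fractions -/

section Tridiagonal

variable {R : Type*} [CommRing R]

/-- `P n h` is the weighted count of Motzkin paths of length `n` from height `0` to height `h`,
with weights `u h` (up to `h`), `b h` (level at `h`) and `c h` (down from `h`). -/
structure IsMotzkin (u b c : ℕ → R) (P : ℕ → ℕ → R) : Prop where
  zero_zero : P 0 0 = 1
  zero_succ : ∀ h, P 0 (h + 1) = 0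
  succ_zero : ∀ n, P (n + 1) 0 = b 0 * P n 0 + c 1 * P n 1
  succ_succ : ∀ n h, P (n + 1) (h + 1) =
    u (h + 1) * P n h + b (h + 1) * P n (h + 1) + c (h + 2) * P n (h + 2)

/-- The generating series, by length, of the paths ending at height `h`, truncated to height
less than `N`. -/
noncomputable def motzkinSeries (u b l : ℕ → R) (N : ℕ) : ℕ → PowerSeries R
  | 0 => jConvergent b l N 0
  | h + 1 => PowerSeries.C (u (h + 1)) * PowerSeries.X * motzkinSeries u b l N h
      * jConvergent b l (N - (h + 1)) (h + 1)

theorem jConvergent_sub_mul (b l : ℕ → R) {N h : ℕ} (hN : h < N) :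
    jConvergent b l (N - h) h = 1 + PowerSeries.C (b h) * PowerSeries.X * jConvergent b l (N - h) h
      + PowerSeries.C (l (h + 1)) * PowerSeries.X ^ 2 * jConvergent b l (N - (h + 1)) (h + 1)
        * jConvergent b l (N - h) h := by
  have := jConvergent_mul b l (N - (h + 1)) h
  rw [show N - (h + 1) + 1 = N - h by omega] at this
  linear_combination this

theorem motzkinSeries_zero (u b c : ℕ → R) {N : ℕ} (hN : 0 < N) :
    motzkinSeries u b (fun m => u m * c m) N 0 = 1 +
      (PowerSeries.C (b 0) * motzkinSeries u b (fun m => u m * c m) N 0 +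
      PowerSeries.C (c 1) * motzkinSeries u b (fun m => u m * c m) N 1) * PowerSeries.X := by
  have := jConvergent_sub_mul b (fun m => u m * c m) hN
  simp only [motzkinSeries, map_mul, Nat.sub_zero, zero_add] at this ⊢
  linear_combination this

/-- This is the relation between consecutive convergents multiplied by the series of paths that
reach height `h` and then step up; the defining product splits a path at its last departure from
each height. -/
theorem motzkinSeries_succ (u b c : ℕ → R) {N h : ℕ} (hN : h + 1 < N) :
    motzkinSeries u b (fun m => u m * c m) N (h + 1) =
      (PowerSeries.C (u (h + 1)) * motzkinSeries u b (fun m => u m * c m) N h +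
      PowerSeries.C (b (h + 1)) * motzkinSeries u b (fun m => u m * c m) N (h + 1) +
      PowerSeries.C (c (h + 2)) * motzkinSeries u b (fun m => u m * c m) N (h + 2))
        * PowerSeries.X := by
  have := jConvergent_sub_mul b (fun m => u m * c m) hN
  simp only [motzkinSeries, map_mul] at this ⊢
  linear_combination PowerSeries.C (u (h + 1)) * PowerSeries.X *
    motzkinSeries u b (fun m => u m * c m) N h * this

/-- Removing the last step lowers the length by one and raises the height by at most one, so `n + h
< N` is inherited and the truncation is never felt. -/
theorem IsMotzkin.coeff_motzkinSeries {u b c : ℕ → R} {P : ℕ → ℕ → R} (hP : IsMotzkin u b c P)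
    {N : ℕ} (n h : ℕ) (hN : n + h < N) :
    PowerSeries.coeff n (motzkinSeries u b (fun m => u m * c m) N h) = P n h := by
  induction n generalizing h with
  | zero =>
    cases h with
    | zero => rw [motzkinSeries_zero u b c (by omega), hP.zero_zero]; simp
    | succ h => rw [motzkinSeries_succ u b c (by omega), hP.zero_succ]; simp
  | succ n ih =>
    cases h with
    | zero =>
      rw [motzkinSeries_zero u b c (by omega), hP.succ_zero, map_add,
        PowerSeries.coeff_succ_mul_X, map_add, PowerSeries.coeff_C_mul, PowerSeries.coeff_C_mul,
        ih 0 (by omega), ih 1 (by omega), PowerSeries.coeff_one]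
      simp
    | succ h =>
      rw [motzkinSeries_succ u b c (by omega), hP.succ_succ,
        PowerSeries.coeff_succ_mul_X, map_add, map_add, PowerSeries.coeff_C_mul,
        PowerSeries.coeff_C_mul, PowerSeries.coeff_C_mul,
        ih h (by omega), ih (h + 1) (by omega), ih (h + 2) (by omega)]

/-- Flajolet's theorem: the J-fraction is the generating function of weighted Motzkin paths. -/
theorem IsMotzkin.coeff_jFraction {u b c : ℕ → R} {P : ℕ → ℕ → R} (hP : IsMotzkin u b c P)
    (n : ℕ) : PowerSeries.coeff n (jFraction b fun m => u m * c m) = P n 0 := by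
  rw [jFraction, PowerSeries.coeff_mk]
  exact hP.coeff_motzkinSeries n 0 (by omega)

/-- Adding `1` to the level weights is the binomial transform. -/
theorem IsMotzkin.binomial {u b c : ℕ → R} {P : ℕ → ℕ → R} (hP : IsMotzkin u b c P) :
    IsMotzkin u (fun h => 1 + b h) c
      (fun n h => ∑ m ∈ Finset.range (n + 1), (n.choose m : R) * P m h) := by
  -- Pascal's rule: the first sum is produced by the extra level weight `1`, the second by one step
  -- of the original recursion.
  have key : ∀ n h, ∑ m ∈ Finset.range (n + 1 + 1), ((n + 1).choose m : R) * P m h =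
      ∑ m ∈ Finset.range (n + 1), (n.choose m : R) * P m h +
      ∑ m ∈ Finset.range (n + 1), (n.choose m : R) * P (m + 1) h := by
    intro n h
    rw [Finset.sum_range_succ']
    conv_rhs => rw [Finset.sum_range_succ']
    simp only [Nat.choose_succ_succ, Nat.cast_add, add_mul, Finset.sum_add_distrib]
    rw [Finset.sum_range_succ (fun m => (n.choose m.succ : R) * P (m + 1) h)]
    simp
    ring
  refine ⟨by simp [hP.zero_zero], fun h => by simp [hP.zero_succ], fun n => ?_, fun n h => ?_⟩
  · simp only [key, hP.succ_zero, Finset.mul_sum, add_mul, ← Finset.sum_add_distrib]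
    exact Finset.sum_congr rfl fun _ _ => by ring
  · simp only [key, hP.succ_succ, Finset.mul_sum, add_mul, ← Finset.sum_add_distrib]
    exact Finset.sum_congr rfl fun _ _ => by ring

theorem IsMotzkin.map {S : Type*} [CommRing S] {u b c : ℕ → R} {P : ℕ → ℕ → R}
    (hP : IsMotzkin u b c P) (f : R →+* S) :
    IsMotzkin (fun h => f (u h)) (fun h => f (b h)) (fun h => f (c h)) fun n h => f (P n h) :=
  ⟨by simp [hP.zero_zero], fun h => by simp [hP.zero_succ], fun n => by simp [hP.succ_zero],
    fun n h => by simp [hP.succ_succ]⟩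

theorem IsMotzkin.unique {u b c : ℕ → R} {P Q : ℕ → ℕ → R} (hP : IsMotzkin u b c P)
    (hQ : IsMotzkin u b c Q) (n h : ℕ) : P n h = Q n h := by
  induction n generalizing h with
  | zero => cases h with
    | zero => rw [hP.zero_zero, hQ.zero_zero]
    | succ h => rw [hP.zero_succ, hQ.zero_succ]
  | succ n ih => cases h with
    | zero => rw [hP.succ_zero, hQ.succ_zero, ih, ih]
    | succ h => rw [hP.succ_succ, hQ.succ_succ, ih, ih, ih]

end Tridiagonal

/-! ### Laguerre histories -/

/-- A step of a Laguerre history: whether it opens, whether it closes, and two counters. -/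
abbrev Step : Type := Bool × Bool × ℕ × ℕ

/-- The histories that extend one in `s` by a step with flags `o`, `c` and counters of sum `r`. -/
def extend (s : Finset (List Step)) (o c : Bool) (r : ℕ) : Finset (List Step) :=
  (s ×ˢ Finset.HasAntidiagonal.antidiagonal r).image fun x => (o, c, x.2) :: x.1

theorem cons_mem_extend {s : Finset (List Step)} {o c : Bool} {r : ℕ} {x : ℕ × ℕ}
    {l : List Step} (hl : l ∈ s) (hx : x.1 + x.2 = r) : (o, c, x) :: l ∈ extend s o c r :=
  Finset.mem_image.2 ⟨(l, x), by simp [hl, hx], rfl⟩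

theorem extend_disjoint (s s' : Finset (List Step)) {o c o' c' : Bool} (r r' : ℕ)
    (h : (o, c) ≠ (o', c')) : Disjoint (extend s o c r) (extend s' o' c' r') := by
  rw [Finset.disjoint_left]
  intro x hx hx'
  simp only [extend, Finset.mem_image] at hx hx'
  obtain ⟨y, -, rfl⟩ := hx
  obtain ⟨z, -, hz⟩ := hx'
  simp only [List.cons.injEq, Prod.mk.injEq] at hz
  exact h (by rw [← hz.1.1, ← hz.1.2.1])

/-- The histories of `n` steps which end at height `h`. -/
def histories : ℕ → ℕ → Finset (List Step)
  | 0, 0 => {[]}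
  | 0, _ + 1 => ∅
  | n + 1, 0 => extend (histories n 0) false false 0 ∪ extend (histories n 1) false true 0
  | n + 1, h + 1 =>
    (extend (histories n h) true false h ∪ extend (histories n (h + 2)) false true (h + 1)) ∪
    (extend (histories n (h + 1)) false false (h + 1) ∪ extend (histories n (h + 1)) true true h)

section HistorySum

variable {R : Type*} [CommSemiring R] (w : Step → R)

/-- The sum of the weights of all steps with given flags and sum of counters. -/
def stepSum (o c : Bool) (r : ℕ) : R := ∑ x ∈ Finset.HasAntidiagonal.antidiagonal r, w (o, c, x)

/-- The sum of the weights of the histories of `n` steps which end at height `h`. -/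
def historySum (n h : ℕ) : R := ∑ l ∈ histories n h, (l.map w).prod

theorem sum_extend (s : Finset (List Step)) (o c : Bool) (r : ℕ) :
    ∑ l ∈ extend s o c r, (l.map w).prod = stepSum w o c r * ∑ l ∈ s, (l.map w).prod := by
  rw [extend, Finset.sum_image, Finset.sum_product, stepSum, Finset.sum_mul_sum,
    Finset.sum_comm]
  · simp
  · rintro ⟨a, b⟩ - ⟨a', b'⟩ - h
    simp only [List.cons.injEq, Prod.mk.injEq, true_and] at h
    simp [h]

theorem historySum_succ_zero (n : ℕ) : historySum w (n + 1) 0 =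
    stepSum w false false 0 * historySum w n 0 + stepSum w false true 0 * historySum w n 1 := by
  rw [historySum, histories, Finset.sum_union (extend_disjoint _ _ _ _ (by simp)),
    sum_extend, sum_extend]
  rfl

theorem historySum_succ_succ (n h : ℕ) : historySum w (n + 1) (h + 1) =
    stepSum w true false h * historySum w n h +
      (stepSum w false false (h + 1) + stepSum w true true h) * historySum w n (h + 1) +
      stepSum w false true (h + 1) * historySum w n (h + 2) := by
  rw [historySum, histories, Finset.sum_union, Finset.sum_union, Finset.sum_union,
    sum_extend, sum_extend, sum_extend, sum_extend]
  · simp only [historySum]; ring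
  all_goals simp [Finset.disjoint_union_left, Finset.disjoint_union_right, extend_disjoint]

end HistorySum

/-- Only height `0` matters later, but the recursion involves neighbouring heights, so the count is
proved for all `h`. With unit weights it reduces to two instances of the absorption identity for
binomial coefficients. -/
theorem card_histories (n h : ℕ) : (histories n h).card = n.factorial * n.choose h := by
  have key : ∀ n h, historySum (fun _ => (1 : ℕ)) n h = n.factorial * n.choose h := by
    intro n
    induction n with
    | zero => intro h; cases h <;> simp [historySum, histories]
    | succ n ih =>
      intro h
      cases h with
      | zero =>
        rw [historySum_succ_zero, ih, ih]
        simp [stepSum, Nat.factorial_succ]; ring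
      | succ h =>
        rw [historySum_succ_succ, ih, ih, ih]
        simp only [stepSum, Finset.sum_const, Finset.Nat.card_antidiagonal, smul_eq_mul, mul_one,
          Nat.factorial_succ, Nat.choose_succ_succ]
        have h1 := Nat.choose_succ_right_eq n h
        have h2 := Nat.choose_succ_right_eq n (h + 1)
        have h3 : n.choose (h + 1) * (h + 1) + n.choose h * h = n.choose h * n := by
          rcases le_or_gt h n with hn | hn
          · rw [h1, ← mul_add, Nat.sub_add_cancel hn]
          · simp [Nat.choose_eq_zero_of_lt hn, Nat.choose_eq_zero_of_lt (hn.trans (Nat.lt_succ_self h))]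
        have h4 : n.choose (h + 1 + 1) * (h + 1 + 1) + n.choose (h + 1) * (h + 1) =
            n.choose (h + 1) * n := by
          rcases le_or_gt (h + 1) n with hn | hn
          · rw [h2, ← mul_add, Nat.sub_add_cancel hn]
          · simp [Nat.choose_eq_zero_of_lt hn, Nat.choose_eq_zero_of_lt (hn.trans (Nat.lt_succ_self _))]
        zify at h3 h4 ⊢
        linear_combination (n.factorial : ℤ) * h3 + (n.factorial : ℤ) * h4
  rw [← key]
  simp [historySum]

theorem cons_mem_histories {n : ℕ} {l : List Step} {o c : Bool} {x : ℕ × ℕ}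
    (hl : l ∈ histories n (x.1 + x.2 + c.toNat)) :
    (o, c, x) :: l ∈ histories (n + 1) (x.1 + x.2 + o.toNat) := by
  obtain ⟨r, hr⟩ : ∃ r, x.1 + x.2 = r := ⟨_, rfl⟩
  rw [hr] at hl ⊢
  cases o <;> cases c <;> cases r <;>
    simp only [Bool.toNat_true, Bool.toNat_false, add_zero, zero_add] at hl ⊢ <;>
    simp only [histories, Finset.mem_union, cons_mem_extend hl hr, true_or, or_true]

/-- A sequence of steps is a history, with heights `H`, that returns to height `0`. -/
structure IsHistory {n : ℕ} (s : Fin n → Step) (H : ℕ → ℕ) : Prop where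
  zero : H 0 = 0
  last : H n = 0
  before : ∀ m : Fin n, H m = (s m).2.2.1 + (s m).2.2.2 + (s m).2.1.toNat
  after : ∀ m : Fin n, H (m + 1) = (s m).2.2.1 + (s m).2.2.2 + (s m).1.toNat

/-- Histories are lists with the latest step first, hence the reversal. The counters describe what
persists through a step: adding the closing flag gives the height before it, adding the opening flag
the height after. -/
theorem reverse_ofFn_mem_histories {n : ℕ} (s : Fin n → Step) (H : ℕ → ℕ) (h0 : H 0 = 0)
    (hb : ∀ m : Fin n, H m = (s m).2.2.1 + (s m).2.2.2 + (s m).2.1.toNat)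
    (ha : ∀ m : Fin n, H (m + 1) = (s m).2.2.1 + (s m).2.2.2 + (s m).1.toNat) :
    (List.ofFn s).reverse ∈ histories n (H n) := by
  induction n with
  | zero => simp [h0, histories]
  | succ n ih =>
    have h1 := ih (fun i => s i.castSucc) (fun m => hb m.castSucc) (fun m => ha m.castSucc)
    have h2 := hb (Fin.last n)
    have h3 := ha (Fin.last n)
    rw [Fin.val_last] at h2 h3
    rw [List.ofFn_succ', List.concat_eq_append, List.reverse_append, h3]
    rw [h2] at h1
    exact cons_mem_histories h1

/-- Summing heights before and after all steps gives the same total, because the heights start and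
end at `0`; the counters cancel. -/
theorem IsHistory.card_opens {n : ℕ} {s : Fin n → Step} {H : ℕ → ℕ} (hs : IsHistory s H) :
    (Finset.univ.filter fun m => (s m).1 = true).card =
      (Finset.univ.filter fun m => (s m).2.1 = true).card := by
  have h1 : ∑ m : Fin n, H (m + 1) = ∑ m : Fin n, H m := by
    rw [Finset.sum_range (f := fun m => H (m + 1)) |>.symm, Finset.sum_range (f := H) |>.symm]
    have := Finset.sum_range_succ H n
    rw [Finset.sum_range_succ', hs.zero, hs.last] at this
    simpa using this
  simp only [hs.before, hs.after, Finset.sum_add_distrib] at h1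
  have h2 : ∀ b : Bool, b.toNat = if b = true then 1 else 0 := by decide
  simp only [h2, ← Finset.card_filter] at h1
  omega

/-- The weight of the flags of a step. -/
def flagWeight {R : Type*} [CommRing R] (a d v : R) : Bool → Bool → R
  | false, false => a
  | true, true => d
  | true, false => v
  | false, true => 1

/-- The number of closing steps. -/
def closeCount {n : ℕ} (s : Fin n → Step) : ℕ :=
  (Finset.univ.filter fun m => (s m).2.1 = true).card

/-- The number of steps which both open and close. -/
def bothCount {n : ℕ} (s : Fin n → Step) : ℕ :=
  (Finset.univ.filter fun m => (s m).1 = true ∧ (s m).2.1 = true).card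

/-- Inclusion-exclusion on the two flags, together with equally many openings and closings. These
identities guarantee that the truncated subtractions in later exponents are genuine. -/
theorem IsHistory.card_flags {n : ℕ} {s : Fin n → Step} {H : ℕ → ℕ} (hs : IsHistory s H) :
    (Finset.univ.filter fun m => (s m).1 = false ∧ (s m).2.1 = false).card + 2 * closeCount s =
      n + bothCount s ∧
    (Finset.univ.filter fun m => (s m).1 = true ∧ (s m).2.1 = false).card + bothCount s =
      closeCount s := by
  have h := hs.card_opens
  have hn : ∑ m : Fin n, 1 = n := by simp
  have key : ∀ o c : Bool,
      (if o = false ∧ c = false then 1 else 0) + ((if o = true then 1 else 0) +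
        (if c = true then 1 else 0)) = 1 + (if o = true ∧ c = true then 1 else 0) ∧
      (if o = true ∧ c = false then 1 else 0) + (if o = true ∧ c = true then 1 else 0) =
        if o = true then 1 else 0 := by decide
  constructor
  · rw [two_mul]
    nth_rewrite 1 [closeCount]
    rw [← h]
    refine Eq.trans ?_ (congrArg (· + bothCount s) hn)
    simp only [closeCount, bothCount, Finset.card_filter, ← Finset.sum_add_distrib, (key _ _).1]
  · rw [closeCount, ← h]
    simp only [bothCount, Finset.card_filter, ← Finset.sum_add_distrib, (key _ _).2]

theorem IsHistory.prod_flagWeight {n : ℕ} {s : Fin n → Step} {H : ℕ → ℕ} (hs : IsHistory s H)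
    {R : Type*} [CommRing R] (a d v : R) :
    ∏ m, flagWeight a d v (s m).1 (s m).2.1 =
      a ^ (n + bothCount s - 2 * closeCount s) * d ^ bothCount s *
        v ^ (closeCount s - bothCount s) := by
  have key : ∀ o c : Bool, flagWeight a d v o c = (if o = false ∧ c = false then a else 1) *
      (if o = true ∧ c = true then d else 1) * (if o = true ∧ c = false then v else 1) := by
    rintro (_ | _) (_ | _) <;> simp [flagWeight]
  obtain ⟨h1, h2⟩ := hs.card_flags
  simp only [key, Finset.prod_mul_distrib, Finset.prod_ite, Finset.prod_const, one_pow, mul_one]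
  rw [← h1, ← h2, Nat.add_sub_cancel, Nat.add_sub_cancel]
  rfl

/-- `[n]_{p,q}` in any ring. -/
def pqNum {R : Type*} [CommRing R] (p q : R) (n : ℕ) : R :=
  ∑ i ∈ Finset.range n, p ^ (n - 1 - i) * q ^ i

/-- The weight of a step. -/
def stepWeight {R : Type*} [CommRing R] (p q a d v : R) (x : Step) : R :=
  flagWeight a d v x.1 x.2.1 * (p ^ x.2.2.2 * q ^ x.2.2.1)

theorem stepSum_stepWeight {R : Type*} [CommRing R] (p q a d v : R) (o c : Bool) (r : ℕ) :
    stepSum (stepWeight p q a d v) o c r = flagWeight a d v o c * pqNum p q (r + 1) := by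
  simp only [stepSum, stepWeight, ← Finset.mul_sum, pqNum]
  rw [Finset.Nat.sum_antidiagonal_eq_sum_range_succ fun i j => p ^ j * q ^ i]
  rfl

theorem isMotzkin_historySum {R : Type*} [CommRing R] (p q a d v : R) :
    IsMotzkin (fun h => v * pqNum p q h) (fun h => a * pqNum p q (h + 1) + d * pqNum p q h)
      (fun h => pqNum p q h) (historySum (stepWeight p q a d v)) where
  zero_zero := by simp [historySum, histories]
  zero_succ h := by simp [historySum, histories]
  succ_zero n := by
    simp [historySum_succ_zero, stepSum_stepWeight, flagWeight, pqNum]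
  succ_succ n h := by
    simp [historySum_succ_succ, stepSum_stepWeight, flagWeight]

/-- If the permutations of `n` letters are encoded injectively by histories, then all histories
of `n` steps which end at height `0` are used. -/
theorem sum_perm_eq_historySum {n : ℕ} (s : Equiv.Perm (Fin n) → Fin n → Step)
    (hs : ∀ σ, ∃ H, IsHistory (s σ) H) (hinj : Function.Injective s)
    {R : Type*} [CommRing R] (w : Step → R) :
    ∑ σ, ∏ m, w (s σ m) = historySum w n 0 := by
  let f : Equiv.Perm (Fin n) → List Step := fun σ => (List.ofFn (s σ)).reverse
  have hf : Function.Injective f :=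
    List.reverse_injective.comp (List.ofFn_injective.comp hinj)
  -- The image lies in a set of the same size `n!`, so injectivity forces surjectivity.
  have himage : Finset.univ.image f = histories n 0 := by
    refine Finset.eq_of_subset_of_card_le ?_ ?_
    · intro l hl
      obtain ⟨σ, -, rfl⟩ := Finset.mem_image.1 hl
      obtain ⟨H, hH⟩ := hs σ
      have := reverse_ofFn_mem_histories (s σ) H hH.zero hH.before hH.after
      rwa [hH.last] at this
    · rw [Finset.card_image_of_injective _ hf, card_histories]
      simp [Fintype.card_perm]
  rw [historySum, ← himage, Finset.sum_image fun x _ y _ h => hf h]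
  refine Finset.sum_congr rfl fun σ _ => ?_
  simp [f, List.prod_ofFn, List.map_ofFn]

theorem sum_perm_eq_coeff_jFraction {n : ℕ} (s : Equiv.Perm (Fin n) → Fin n → Step)
    (hs : ∀ σ, ∃ H, IsHistory (s σ) H) (hinj : Function.Injective s)
    {R : Type*} [CommRing R] (p q a d v : R) :
    ∑ σ, p ^ (∑ m, (s σ m).2.2.2) * q ^ (∑ m, (s σ m).2.2.1) *
      (a ^ (n + bothCount (s σ) - 2 * closeCount (s σ)) * d ^ bothCount (s σ) *
        v ^ (closeCount (s σ) - bothCount (s σ))) =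
    PowerSeries.coeff n (jFraction (fun h => a * pqNum p q (h + 1) + d * pqNum p q h)
      fun h => v * pqNum p q h ^ 2) := by
  have h1 := (isMotzkin_historySum p q a d v).coeff_jFraction n
  simp only [mul_assoc v, ← sq] at h1
  rw [h1, ← sum_perm_eq_historySum s hs hinj]
  refine Finset.sum_congr rfl fun σ _ => ?_
  obtain ⟨H, hH⟩ := hs σ
  rw [← hH.prod_flagWeight]
  simp only [stepWeight, Finset.prod_mul_distrib, Finset.prod_pow_eq_pow_sum]
  ring

/-! ### Coding by crossings and nestings -/

/-- An element of a finite set is determined by its rank; this is how counters are decoded in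
`cycleStep_injective`. -/
theorem eq_of_card_filter_lt {α : Type*} [LinearOrder α] {E : Finset α} {i j : α} (hi : i ∈ E)
    (hj : j ∈ E) (h : (E.filter fun x => x < i).card = (E.filter fun x => x < j).card) :
    i = j := by
  by_contra hne
  wlog hlt : i < j generalizing i j
  · exact this hj hi h.symm (Ne.symm hne) (lt_of_le_of_ne (not_lt.1 hlt) (Ne.symm hne))
  refine absurd h (ne_of_lt (Finset.card_lt_card ⟨?_, fun hss => ?_⟩))
  · intro x hx
    simp only [Finset.mem_filter] at hx ⊢
    exact ⟨hx.1, hx.2.trans hlt⟩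
  · have := hss (Finset.mem_filter.2 ⟨hi, hlt⟩)
    simp at this

theorem perm_inv_apply {α : Type*} (σ : Equiv.Perm α) (a : α) : σ⁻¹ (σ a) = a :=
  σ.symm_apply_apply a

theorem decide_toNat_eq_card {α : Type*} [Fintype α] [DecidableEq α] (a : α) (P : Prop)
    [Decidable P] : (decide P).toNat = (Finset.univ.filter fun j => j = a ∧ P).card := by
  by_cases h : P <;> simp [h, Finset.filter_eq']

section Cycle

variable {n : ℕ}

/-- Crossings whose first arc has head `m`. -/
def crosAt (σ : Equiv.Perm (Fin n)) (m : Fin n) : ℕ :=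
  (Finset.univ.filter fun j =>
    (σ⁻¹ m < j ∧ j ≤ m ∧ m < σ j) ∨ (σ⁻¹ m > j ∧ j > m ∧ m > σ j)).card

/-- Nestings whose inner arc has head `m`. -/
def nestAt (σ : Equiv.Perm (Fin n)) (m : Fin n) : ℕ :=
  (Finset.univ.filter fun j =>
    (j < σ⁻¹ m ∧ σ⁻¹ m ≤ m ∧ m < σ j) ∨ (j > σ⁻¹ m ∧ σ⁻¹ m > m ∧ m > σ j)).card

theorem card_filter_prod_eq_sum (P : Fin n → Fin n → Prop) [DecidableRel P]
    (σ : Equiv.Perm (Fin n)) :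
    (Finset.univ.filter fun x : Fin n × Fin n => P x.1 x.2).card =
      ∑ m, (Finset.univ.filter fun j => P (σ⁻¹ m) j).card := by
  simp only [Finset.card_filter, Fintype.sum_prod_type]
  exact (Equiv.sum_comp σ⁻¹ fun i => ∑ j, if P i j then 1 else 0).symm

theorem card_filter_prod_eq_sum' (P : Fin n → Fin n → Prop) [DecidableRel P]
    (σ : Equiv.Perm (Fin n)) :
    (Finset.univ.filter fun x : Fin n × Fin n => P x.1 x.2).card =
      ∑ m, (Finset.univ.filter fun j => P j (σ⁻¹ m)).card := by
  simp only [Finset.card_filter, Fintype.sum_prod_type_right]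
  exact (Equiv.sum_comp σ⁻¹ fun i => ∑ j, if P j i then 1 else 0).symm

theorem sum_crosAt (σ : Equiv.Perm (Fin n)) : ∑ m, crosAt σ m = cros σ := by
  rw [cros, card_filter_prod_eq_sum (fun i j => (i < j ∧ j ≤ σ i ∧ σ i < σ j) ∨
    (i > j ∧ j > σ i ∧ σ i > σ j)) σ]
  simp [crosAt]

theorem sum_nestAt (σ : Equiv.Perm (Fin n)) : ∑ m, nestAt σ m = nest σ := by
  rw [nest, card_filter_prod_eq_sum' (fun i j => (i < j ∧ j ≤ σ j ∧ σ j < σ i) ∨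
    (i > j ∧ j > σ j ∧ σ j > σ i)) σ]
  simp [nestAt]

/-- The step, at the value `m`, of the history that records drops, crossings and nestings. -/
def cycleStep (σ : Equiv.Perm (Fin n)) (m : Fin n) : Step :=
  (decide (m < σ⁻¹ m), decide (σ m < m), crosAt σ m, nestAt σ m)

theorem bothCount_cycleStep (σ : Equiv.Perm (Fin n)) : bothCount (cycleStep σ) = cdfall σ := by
  simp [bothCount, cycleStep, cdfall]

theorem closeCount_cycleStep (σ : Equiv.Perm (Fin n)) : closeCount (cycleStep σ) = drop σ := by
  simp [closeCount, cycleStep, drop]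

/-- As many points of `{0, ..., m}` are sent out of it as points out of it are sent in. -/
theorem card_exit_eq_card_enter (σ : Equiv.Perm (Fin n)) (m : Fin n) :
    (Finset.univ.filter fun j => j ≤ m ∧ m < σ j).card =
      (Finset.univ.filter fun j => m < j ∧ σ j ≤ m).card := by
  have h1 : (Finset.univ.filter fun j => σ j ≤ m).card =
      (Finset.univ.filter fun j => j ≤ m).card := by
    simp only [Finset.card_filter]
    exact Equiv.sum_comp σ fun i => if i ≤ m then 1 else 0
  have h2 := Finset.card_filter_add_card_filter_not (s := Finset.univ.filter fun j => σ j ≤ m)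
    fun j => j ≤ m
  have h3 := Finset.card_filter_add_card_filter_not (s := Finset.univ.filter fun j => j ≤ m)
    fun j => σ j ≤ m
  simp only [Finset.filter_filter, not_le] at h2 h3
  have h4 : ∀ j, (σ j ≤ m ∧ j ≤ m) = (j ≤ m ∧ σ j ≤ m) := fun j => by rw [and_comm]
  have h5 : ∀ j, (σ j ≤ m ∧ m < j) = (m < j ∧ σ j ≤ m) := fun j => by rw [and_comm]
  simp only [h4, h5] at h2
  omega

/-- If `m` is the value of a drop, its crossings and nestings sort the other drops passing over `m`
by their starting point. Otherwise they sort the arcs that leave `{0, ..., m}` upwards, and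
`card_exit_eq_card_enter` converts these into drops. -/
theorem crosAt_add_nestAt (σ : Equiv.Perm (Fin n)) (m : Fin n) :
    crosAt σ m + nestAt σ m = (Finset.univ.filter fun j => m < j ∧ σ j < m).card := by
  have hne : ∀ j, m < σ j ∨ σ j < m → j ≠ σ⁻¹ m := by
    rintro j hj rfl
    simp at hj
  rw [crosAt, nestAt, ← Finset.card_union_of_disjoint]
  · rcases le_or_gt (σ⁻¹ m) m with h | h
    · have h1 := card_exit_eq_card_enter σ m
      have h2 : (Finset.univ.filter fun j => m < j ∧ σ j ≤ m) =
          Finset.univ.filter fun j => m < j ∧ σ j < m := by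
        refine Finset.filter_congr fun j _ => and_congr_right fun hj => ?_
        refine ⟨fun h' => lt_of_le_of_ne h' ?_, le_of_lt⟩
        rintro rfl
        simp only [perm_inv_apply] at h
        omega
      rw [← h2, ← h1, ← Finset.filter_or]
      congr 1
      refine Finset.filter_congr fun j _ => ?_
      have := hne j
      constructor
      · rintro ((h | h) | (h | h)) <;> constructor <;> omega
      · intro h'
        rcases lt_or_gt_of_ne (this (Or.inl h'.2)) with h'' | h'' <;> omega
    · rw [← Finset.filter_or]
      congr 1
      refine Finset.filter_congr fun j _ => ?_
      have := hne j
      constructor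
      · rintro ((h | h) | (h | h)) <;> constructor <;> omega
      · intro h'
        rcases lt_or_gt_of_ne (this (Or.inr h'.2)) with h'' | h'' <;> omega
  · rw [Finset.disjoint_filter]
    intro j _ h h'
    omega

/-- The number of drops over `k`. -/
def dropHeight (σ : Equiv.Perm (Fin n)) (k : ℕ) : ℕ :=
  (Finset.univ.filter fun j : Fin n => k ≤ (j : ℕ) ∧ (σ j : ℕ) < k).card

/-- Moving the cut from below `m` to above `m` discards the drop starting at `m` and gains the drop
landing at `m`; all other drops over the cut persist. -/
theorem isHistory_cycleStep (σ : Equiv.Perm (Fin n)) :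
    IsHistory (cycleStep σ) (dropHeight σ) where
  zero := by simp [dropHeight]
  last := by simp [dropHeight]
  before m := by
    simp only [cycleStep, crosAt_add_nestAt, dropHeight]
    rw [decide_toNat_eq_card m, ← Finset.card_union_of_disjoint, ← Finset.filter_or]
    · congr 1
      refine Finset.filter_congr fun j _ => ?_
      constructor
      · rintro ⟨h1, h2⟩
        rcases eq_or_ne j m with rfl | h
        · exact Or.inr ⟨rfl, h2⟩
        · left; omega
      · rintro (h | ⟨rfl, h⟩) <;> omega
    · rw [Finset.disjoint_filter]
      intro j _ h h'
      omega
  after m := by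
    simp only [cycleStep, crosAt_add_nestAt, dropHeight]
    rw [decide_toNat_eq_card (σ⁻¹ m), ← Finset.card_union_of_disjoint, ← Finset.filter_or]
    · congr 1
      refine Finset.filter_congr fun j _ => ?_
      constructor
      · rintro ⟨h1, h2⟩
        rcases eq_or_ne (σ j) m with rfl | h
        · right; simp; omega
        · left; omega
      · rintro (h | ⟨rfl, h⟩)
        · omega
        · simp; omega
    · rw [Finset.disjoint_filter]
      rintro j _ h ⟨rfl, h'⟩
      simp at h

/-- The flags tell which values and positions belong to drops. Preimages of non-drop values are
recovered in increasing order of the value, those of drop values in decreasing order: the set of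
still available starting points is known, and `crosAt` is the rank of the preimage in it. -/
theorem cycleStep_injective : Function.Injective (cycleStep (n := n)) := by
  intro σ τ hst
  have hP : ∀ m, m < σ⁻¹ m ↔ m < τ⁻¹ m := fun m => by
    have := congrArg (fun s => (s m).1) hst
    simpa [cycleStep] using this
  have hS : ∀ m, σ m < m ↔ τ m < m := fun m => by
    have := congrArg (fun s => (s m).2.1) hst
    simpa [cycleStep] using this
  have hc : ∀ m, crosAt σ m = crosAt τ m := fun m => congrArg (fun s => (s m).2.2.1) hst
  have hup : ∀ m, ¬ m < σ⁻¹ m → σ⁻¹ m = τ⁻¹ m := by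
    intro m
    induction m using WellFoundedLT.induction with
    | ind m ih =>
    intro hm
    have hm' := mt (hP m).2 hm
    -- A non-drop position whose image under one permutation is below `m` was already decoded, so it
    -- has the same image under the other.
    have hE : ∀ j, (j ≤ m ∧ m ≤ σ j) ↔ (j ≤ m ∧ m ≤ τ j) := by
      intro j
      refine and_congr_right fun hj => ?_
      constructor
      · intro h
        by_contra hlt
        have h1 : ¬ τ j < j := fun h' => by have := (hS j).2 h'; omega
        have h2 := ih (τ j) (by omega) (by rw [hP]; simpa using h1)
        rw [perm_inv_apply, Equiv.Perm.inv_eq_iff_eq] at h2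
        omega
      · intro h
        by_contra hlt
        have h1 : ¬ σ j < j := fun h' => by have := (hS j).1 h'; omega
        have h2 := ih (σ j) (by omega) (by simpa using h1)
        rw [perm_inv_apply, eq_comm, Equiv.Perm.inv_eq_iff_eq] at h2
        omega
    -- Crossings of an upward arc start to the right of `ρ⁻¹ m`, so `crosAt` is a rank from the top:
    -- hence the dual order.
    have hcard : ∀ ρ : Equiv.Perm (Fin n), ¬ m < ρ⁻¹ m → crosAt ρ m =
        (((Finset.univ.filter fun j => j ≤ m ∧ m ≤ ρ j).image OrderDual.toDual).filter
          fun x => x < OrderDual.toDual (ρ⁻¹ m)).card := by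
      intro ρ hρ
      rw [Finset.filter_image, Finset.card_image_of_injective _ OrderDual.toDual.injective,
        Finset.filter_filter, crosAt]
      congr 1
      refine Finset.filter_congr fun j _ => ?_
      rw [OrderDual.toDual_lt_toDual]
      constructor
      · rintro (h | h) <;> omega
      · intro h
        have : m ≠ ρ j := by rintro rfl; simp at h
        omega
    have h1 := hcard σ hm
    have h2 := hcard τ hm'
    rw [← hc m, h1] at h2
    simp only [← hE] at h2
    refine OrderDual.toDual.injective (eq_of_card_filter_lt ?_ ?_ h2)
    · simpa using hm
    · simp only [hE]
      simpa using hm'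
  have hdown : ∀ m, m < σ⁻¹ m → σ⁻¹ m = τ⁻¹ m := by
    intro m
    induction m using WellFoundedGT.induction with
    | ind m ih =>
    intro hm
    have hm' := (hP m).1 hm
    have hE : ∀ j, (m < j ∧ σ j ≤ m) ↔ (m < j ∧ τ j ≤ m) := by
      intro j
      refine and_congr_right fun hj => ?_
      constructor
      · intro h
        by_contra hlt
        have h1 : τ j < j := (hS j).1 (by omega)
        have h2 := ih (τ j) (by omega) (by rw [hP]; simpa using h1)
        rw [perm_inv_apply, Equiv.Perm.inv_eq_iff_eq] at h2
        omega
      · intro h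
        by_contra hlt
        have h1 : σ j < j := (hS j).2 (by omega)
        have h2 := ih (σ j) (by omega) (by simpa using h1)
        rw [perm_inv_apply, eq_comm, Equiv.Perm.inv_eq_iff_eq] at h2
        omega
    have hcard : ∀ ρ : Equiv.Perm (Fin n), m < ρ⁻¹ m → crosAt ρ m =
        ((Finset.univ.filter fun j => m < j ∧ ρ j ≤ m).filter fun x => x < ρ⁻¹ m).card := by
      intro ρ hρ
      rw [Finset.filter_filter, crosAt]
      congr 1
      refine Finset.filter_congr fun j _ => ?_
      constructor
      · rintro (h | h) <;> omega
      · intro h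
        have : m ≠ ρ j := by rintro rfl; simp at h
        omega
    have h1 := hcard σ hm
    have h2 := hcard τ hm'
    rw [← hc m, h1] at h2
    simp only [← hE] at h2
    refine eq_of_card_filter_lt ?_ ?_ h2
    · simpa using hm
    · simp only [hE]
      simpa using hm'
  refine inv_injective (Equiv.ext fun m => ?_)
  by_cases h : m < σ⁻¹ m
  · exact hdown m h
  · exact hup m h

end Cycle

/-! ### Coding by the patterns 31-2 and 2-31 -/

section Linear

variable {n : ℕ}

/-- Occurrences of 31-2 whose last letter is `m`. -/
def leftAt (σ : Equiv.Perm (Fin n)) (m : Fin n) : ℕ :=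
  (Finset.univ.filter fun i => i < σ⁻¹ m ∧
    ∃ h : Fin n, (i : ℕ) = h + 1 ∧ σ i < m ∧ m < σ h).card

/-- Occurrences of 2-31 whose first letter is `m`. -/
def rightAt (σ : Equiv.Perm (Fin n)) (m : Fin n) : ℕ :=
  (Finset.univ.filter fun j => σ⁻¹ m < j ∧
    ∃ k : Fin n, (k : ℕ) = j + 1 ∧ σ k < m ∧ m < σ j).card

theorem sum_leftAt (σ : Equiv.Perm (Fin n)) : ∑ m, leftAt σ m = pat31_2 σ := by
  rw [pat31_2, card_filter_prod_eq_sum' (fun i j => i < j ∧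
    ∃ h : Fin n, (i : ℕ) = h + 1 ∧ σ i < σ j ∧ σ j < σ h) σ]
  simp [leftAt]

theorem sum_rightAt (σ : Equiv.Perm (Fin n)) : ∑ m, rightAt σ m = pat2_31 σ := by
  rw [pat2_31, card_filter_prod_eq_sum (fun i j => i < j ∧
    ∃ k : Fin n, (k : ℕ) = j + 1 ∧ σ k < σ i ∧ σ i < σ j) σ]
  simp [rightAt]

/-- The bottoms of the descents from `k` or above to below `k`. -/
def straddles (σ : Equiv.Perm (Fin n)) (k : ℕ) : Finset (Fin n) :=
  Finset.univ.filter fun j => (σ j : ℕ) < k ∧ ∃ i : Fin n, (j : ℕ) = i + 1 ∧ k ≤ (σ i : ℕ)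

/-- The bottoms of the descents from above `m` to below `m`. -/
def core (σ : Equiv.Perm (Fin n)) (m : Fin n) : Finset (Fin n) :=
  Finset.univ.filter fun j => σ j < m ∧ ∃ i : Fin n, (j : ℕ) = i + 1 ∧ m < σ i

/-- The bottom of the descent with top `m`, if there is one. -/
def below (σ : Equiv.Perm (Fin n)) (m : Fin n) : Finset (Fin n) :=
  Finset.univ.filter fun j => (j : ℕ) = σ⁻¹ m + 1 ∧ σ j < m

/-- The position of `m`, if it is a descent bottom. -/
def bottom (σ : Equiv.Perm (Fin n)) (m : Fin n) : Finset (Fin n) :=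
  Finset.univ.filter fun j => j = σ⁻¹ m ∧ ∃ i : Fin n, (j : ℕ) = i + 1 ∧ m < σ i

theorem straddles_eq (σ : Equiv.Perm (Fin n)) (m : Fin n) :
    straddles σ m = core σ m ∪ below σ m := by
  ext j
  simp only [straddles, core, below, Finset.mem_union, Finset.mem_filter, Finset.mem_univ,
    true_and]
  constructor
  · rintro ⟨h1, i, hi, h2⟩
    rcases eq_or_ne (σ i) m with rfl | h
    · exact Or.inr ⟨by rw [perm_inv_apply]; exact hi, h1⟩
    · exact Or.inl ⟨h1, i, hi, by omega⟩
  · rintro (⟨h1, i, hi, h2⟩ | ⟨h1, h2⟩)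
    · exact ⟨h1, i, hi, by omega⟩
    · exact ⟨h2, σ⁻¹ m, h1, by simp⟩

theorem straddles_succ_eq (σ : Equiv.Perm (Fin n)) (m : Fin n) :
    straddles σ (m + 1) = core σ m ∪ bottom σ m := by
  ext j
  simp only [straddles, core, bottom, Finset.mem_union, Finset.mem_filter, Finset.mem_univ,
    true_and]
  constructor
  · rintro ⟨h1, i, hi, h2⟩
    rcases eq_or_ne (σ j) m with rfl | h
    · exact Or.inr ⟨(perm_inv_apply σ j).symm, i, hi, by omega⟩
    · exact Or.inl ⟨by omega, i, hi, by omega⟩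
  · rintro (⟨h1, i, hi, h2⟩ | ⟨rfl, i, hi, h2⟩)
    · exact ⟨by omega, i, hi, by omega⟩
    · exact ⟨by simp, i, hi, by omega⟩

theorem disjoint_core_below (σ : Equiv.Perm (Fin n)) (m : Fin n) :
    Disjoint (core σ m) (below σ m) := by
  rw [core, below, Finset.disjoint_filter]
  rintro j - ⟨-, i, hi, h2⟩ ⟨h3, -⟩
  obtain rfl : i = σ⁻¹ m := by omega
  simp at h2

theorem disjoint_core_bottom (σ : Equiv.Perm (Fin n)) (m : Fin n) :
    Disjoint (core σ m) (bottom σ m) := by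
  rw [core, bottom, Finset.disjoint_filter]
  rintro j - ⟨h1, -⟩ ⟨rfl, -⟩
  simp at h1

/-- Pairs of consecutive positions may be counted by either member. -/
theorem card_filter_exists_succ (P : Fin n → Fin n → Prop) [DecidableRel P] :
    (Finset.univ.filter fun j : Fin n => ∃ k : Fin n, (k : ℕ) = j + 1 ∧ P j k).card =
      (Finset.univ.filter fun k : Fin n => ∃ j : Fin n, (k : ℕ) = j + 1 ∧ P j k).card := by
  let T : Finset (Fin n × Fin n) :=
    Finset.univ.filter fun x => (x.2 : ℕ) = x.1 + 1 ∧ P x.1 x.2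
  have h1 : (T.image Prod.fst).card = T.card := by
    refine Finset.card_image_of_injOn fun x hx y hy h => ?_
    simp only [T, Finset.coe_filter, Set.mem_ofPred_eq] at hx hy
    refine Prod.ext h (Fin.ext ?_)
    rw [hx.2.1, hy.2.1, h]
  have h2 : (T.image Prod.snd).card = T.card := by
    refine Finset.card_image_of_injOn fun x hx y hy h => ?_
    simp only [T, Finset.coe_filter, Set.mem_ofPred_eq] at hx hy
    refine Prod.ext (Fin.ext ?_) h
    have := congrArg Fin.val h
    omega
  have h3 : T.image Prod.fst =
      Finset.univ.filter fun j : Fin n => ∃ k : Fin n, (k : ℕ) = j + 1 ∧ P j k := by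
    ext; simp [T]
  have h4 : T.image Prod.snd =
      Finset.univ.filter fun k : Fin n => ∃ j : Fin n, (k : ℕ) = j + 1 ∧ P j k := by
    ext; simp [T]
  rw [← h3, ← h4, h1, h2]

theorem leftAt_eq (σ : Equiv.Perm (Fin n)) (m : Fin n) :
    leftAt σ m = ((core σ m).filter fun j => j ≤ σ⁻¹ m).card := by
  rw [leftAt, core, Finset.filter_filter]
  congr 1
  refine Finset.filter_congr fun j _ => ?_
  constructor
  · rintro ⟨h, i, hi, h1, h2⟩
    exact ⟨⟨h1, i, hi, h2⟩, h.le⟩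
  · rintro ⟨⟨h1, i, hi, h2⟩, h⟩
    refine ⟨lt_of_le_of_ne h ?_, i, hi, h1, h2⟩
    rintro rfl
    simp at h1

/-- The pattern indexes a descent by its top, `core` by its bottom. Both lie on the same side of
`m`, since `m` is strictly between the two letters and so is neither of them. -/
theorem rightAt_eq (σ : Equiv.Perm (Fin n)) (m : Fin n) :
    rightAt σ m = ((core σ m).filter fun j => ¬ j ≤ σ⁻¹ m).card := by
  have h1 := card_filter_exists_succ fun j k => σ⁻¹ m < j ∧ σ k < m ∧ m < σ j
  have h2 : rightAt σ m = (Finset.univ.filter fun j : Fin n =>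
      ∃ k : Fin n, (k : ℕ) = j + 1 ∧ σ⁻¹ m < j ∧ σ k < m ∧ m < σ j).card := by
    rw [rightAt]
    congr 1
    refine Finset.filter_congr fun j _ => ?_
    constructor
    · rintro ⟨h, k, hk, h'⟩
      exact ⟨k, hk, h, h'⟩
    · rintro ⟨k, hk, h, h'⟩
      exact ⟨h, k, hk, h'⟩
  rw [h2, h1, core, Finset.filter_filter]
  congr 1
  refine Finset.filter_congr fun j _ => ?_
  constructor
  · rintro ⟨i, hi, h, h1, h2⟩
    exact ⟨⟨h1, i, hi, h2⟩, by omega⟩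
  · rintro ⟨⟨h1, i, hi, h2⟩, h⟩
    refine ⟨i, hi, ?_, h1, h2⟩
    have : i ≠ σ⁻¹ m := by
      rintro rfl
      simp at h2
    omega

theorem leftAt_add_rightAt (σ : Equiv.Perm (Fin n)) (m : Fin n) :
    leftAt σ m + rightAt σ m = (core σ m).card := by
  rw [leftAt_eq, rightAt_eq]
  exact Finset.card_filter_add_card_filter_not _

/-- The step, at the value `m`, of the history that records descents and the two patterns. -/
def linearStep (σ : Equiv.Perm (Fin n)) (m : Fin n) : Step :=
  (decide (bottom σ m).Nonempty, decide (below σ m).Nonempty, leftAt σ m, rightAt σ m)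

theorem toNat_decide_nonempty {α : Type*} {s : Finset α} (h : s.card ≤ 1) :
    (decide s.Nonempty).toNat = s.card := by
  rcases s.eq_empty_or_nonempty with rfl | hs
  · simp
  · have := hs.card_pos
    simp [hs]
    omega

theorem card_below_le (σ : Equiv.Perm (Fin n)) (m : Fin n) : (below σ m).card ≤ 1 := by
  refine Finset.card_le_one.2 fun i hi j hj => ?_
  simp only [below, Finset.mem_filter] at hi hj
  omega

theorem card_bottom_le (σ : Equiv.Perm (Fin n)) (m : Fin n) : (bottom σ m).card ≤ 1 := by
  refine Finset.card_le_one.2 fun i hi j hj => ?_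
  simp only [bottom, Finset.mem_filter] at hi hj
  rw [hi.2.1, hj.2.1]

/-- The height counts descents straddling the cut between letters. Passing the letter `m` closes the
descent with top `m`, opens the one with bottom `m`, and leaves `core` untouched. -/
theorem isHistory_linearStep (σ : Equiv.Perm (Fin n)) :
    IsHistory (linearStep σ) fun k => (straddles σ k).card where
  zero := by simp [straddles]
  last := by
    rw [straddles, Finset.card_eq_zero, Finset.filter_eq_empty_iff]
    rintro j - ⟨-, i, -, h⟩
    omega
  before m := by
    simp only [linearStep, leftAt_add_rightAt, toNat_decide_nonempty (card_below_le σ m)]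
    rw [straddles_eq, Finset.card_union_of_disjoint (disjoint_core_below σ m)]
  after m := by
    simp only [linearStep, leftAt_add_rightAt, toNat_decide_nonempty (card_bottom_le σ m)]
    rw [straddles_succ_eq, Finset.card_union_of_disjoint (disjoint_core_bottom σ m)]

theorem card_filter_inv_apply (σ : Equiv.Perm (Fin n)) (P : Fin n → Prop) [DecidablePred P] :
    (Finset.univ.filter fun m => P (σ⁻¹ m)).card = (Finset.univ.filter P).card := by
  simp only [Finset.card_filter]
  exact Equiv.sum_comp σ⁻¹ fun i => if P i then 1 else 0

theorem closeCount_linearStep (σ : Equiv.Perm (Fin n)) : closeCount (linearStep σ) = des σ := by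
  rw [closeCount, des, ← card_filter_inv_apply σ fun i =>
    ∃ j : Fin n, (j : ℕ) = i + 1 ∧ σ i > σ j]
  congr 1
  refine Finset.filter_congr fun m _ => ?_
  simp [linearStep, below, Finset.filter_nonempty_iff]

theorem bothCount_linearStep (σ : Equiv.Perm (Fin n)) : bothCount (linearStep σ) = dd σ := by
  rw [bothCount, dd, ← card_filter_inv_apply σ fun i =>
    ∃ h j : Fin n, (i : ℕ) = h + 1 ∧ (j : ℕ) = i + 1 ∧ σ h > σ i ∧ σ i > σ j]
  congr 1
  refine Finset.filter_congr fun m _ => ?_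
  simp only [linearStep, below, bottom, Finset.filter_nonempty_iff, decide_eq_true_eq,
    Finset.mem_univ, true_and]
  constructor
  · rintro ⟨⟨_, rfl, h, hh, h1⟩, j, hj, h2⟩
    exact ⟨h, j, hh, hj, by simpa using h1, by simpa using h2⟩
  · rintro ⟨h, j, hh, hj, h1, h2⟩
    exact ⟨⟨_, rfl, h, hh, by simpa using h1⟩, j, hj, by simpa using h2⟩

/-- The number of descents straddling `k` not after the letter `x`. -/
def rankAt (σ : Equiv.Perm (Fin n)) (k : ℕ) (x : Fin n) : ℕ :=
  ((straddles σ k).filter fun j => j ≤ σ⁻¹ x).card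

theorem rankAt_eq (σ : Equiv.Perm (Fin n)) (m x : Fin n) :
    rankAt σ m x = ((core σ m).filter fun j => j ≤ σ⁻¹ x).card +
      if σ⁻¹ m < σ⁻¹ x then (below σ m).card else 0 := by
  rw [rankAt, straddles_eq, Finset.filter_union, Finset.card_union_of_disjoint
    (Finset.disjoint_filter_filter (disjoint_core_below σ m))]
  congr 1
  split_ifs with h
  · rw [Finset.filter_true_of_mem]
    intro j hj
    simp only [below, Finset.mem_filter] at hj
    omega
  · rw [Finset.card_eq_zero, Finset.filter_false_of_mem]
    intro j hj
    simp only [below, Finset.mem_filter] at hj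
    omega

theorem rankAt_succ_eq (σ : Equiv.Perm (Fin n)) (m x : Fin n) :
    rankAt σ (m + 1) x = ((core σ m).filter fun j => j ≤ σ⁻¹ x).card +
      if σ⁻¹ m ≤ σ⁻¹ x then (bottom σ m).card else 0 := by
  rw [rankAt, straddles_succ_eq, Finset.filter_union, Finset.card_union_of_disjoint
    (Finset.disjoint_filter_filter (disjoint_core_bottom σ m))]
  congr 1
  split_ifs with h
  · rw [Finset.filter_true_of_mem]
    intro j hj
    simp only [bottom, Finset.mem_filter] at hj
    rw [hj.2.1]; exact h
  · rw [Finset.card_eq_zero, Finset.filter_false_of_mem]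
    intro j hj
    simp only [bottom, Finset.mem_filter] at hj
    rw [hj.2.1]; exact h

/-- Between a letter `≥ m` and a later letter `< m` there is a descent straddling `m`. -/
theorem exists_straddle (σ : Equiv.Perm (Fin n)) (k : ℕ) {a b : Fin n} (hab : a < b)
    (ha : k ≤ σ a) (hb : (σ b : ℕ) < k) : ∃ j ∈ straddles σ k, a < j ∧ j ≤ b := by
  -- The required bottom is the first position after `a` with a letter below `k`; by minimality its
  -- predecessor carries a letter at least `k`.
  have hne : (Finset.univ.filter fun j => a < j ∧ (σ j : ℕ) < k).Nonempty :=
    ⟨b, by simp [hab, hb]⟩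
  have hmem := Finset.min'_mem _ hne
  set j := Finset.min' _ hne with hj
  simp only [Finset.mem_filter, Finset.mem_univ, true_and] at hmem
  refine ⟨j, ?_, hmem.1, Finset.min'_le _ _ (by simp [hab, hb])⟩
  simp only [straddles, Finset.mem_filter, Finset.mem_univ, true_and]
  refine ⟨hmem.2, ⟨(j : ℕ) - 1, by omega⟩, by simp only; omega, ?_⟩
  by_contra hlt
  rw [not_le] at hlt
  have h1 : a ≠ ⟨(j : ℕ) - 1, by omega⟩ := by
    intro h
    rw [← h] at hlt
    omega
  have h2 : j ≤ ⟨(j : ℕ) - 1, by omega⟩ := by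
    refine Finset.min'_le _ _ ?_
    simp only [Finset.mem_filter, Finset.mem_univ, true_and]
    refine ⟨lt_of_le_of_ne ?_ h1, hlt⟩
    rw [Fin.le_def]
    simp only
    omega
  rw [Fin.le_def] at h2
  simp only at h2
  omega

/-- If `m` precedes the smaller letter `x`, a straddling descent ends between them, so `x` sees
strictly more descents than `m`. If `x` precedes `m`, every descent counted for `x` is counted for
`m`. -/
theorem inv_lt_inv_iff_leftAt_lt_rankAt (σ : Equiv.Perm (Fin n)) {m x : Fin n} (hx : x < m) :
    σ⁻¹ m < σ⁻¹ x ↔ leftAt σ m < rankAt σ m x := by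
  rw [leftAt_eq]
  constructor
  · intro h
    obtain ⟨j, hj, h1, h2⟩ := exists_straddle σ m h (by simp) (by simpa using hx)
    refine Finset.card_lt_card ⟨fun i hi => ?_, fun hss => ?_⟩
    · rw [Finset.mem_filter] at hi ⊢
      exact ⟨by rw [straddles_eq]; exact Finset.mem_union_left _ hi.1, hi.2.trans h.le⟩
    · have := (Finset.mem_filter.1 (hss (Finset.mem_filter.2 ⟨hj, h2⟩))).2
      omega
  · intro h
    by_contra hle
    rw [not_lt] at hle
    rw [rankAt_eq, if_neg (not_lt.2 hle), add_zero] at h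
    refine absurd h (not_lt.2 (Finset.card_le_card fun i hi => ?_))
    rw [Finset.mem_filter] at hi ⊢
    exact ⟨hi.1, hi.2.trans hle⟩

/-- Then `τ⁻¹ σ` is increasing, and the identity is the only order automorphism of `Fin n`. -/
theorem eq_of_inv_lt_inv_iff {σ τ : Equiv.Perm (Fin n)}
    (h : ∀ x m, x < m → (σ⁻¹ m < σ⁻¹ x ↔ τ⁻¹ m < τ⁻¹ x)) : σ = τ := by
  have h' : StrictMono fun i => τ⁻¹ (σ i) := by
    intro i j hij
    have hne : σ i ≠ σ j := fun h => hij.ne (σ.injective h)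
    rcases lt_or_gt_of_ne hne with hlt | hgt
    · have h1 := h _ _ hlt
      rw [perm_inv_apply, perm_inv_apply] at h1
      exact lt_of_le_of_ne (not_lt.1 (mt h1.2 (not_lt.2 hij.le)))
        fun h => hne (τ⁻¹.injective h)
    · have h1 := h _ _ hgt
      rw [perm_inv_apply, perm_inv_apply] at h1
      exact h1.1 hij
  have h2 : StrictMono.orderIsoOfSurjective _ h' (τ⁻¹.surjective.comp σ.surjective) =
    OrderIso.refl (Fin n) := Subsingleton.elim _ _
  refine Equiv.ext fun i => ?_
  have h3 : τ⁻¹ (σ i) = i := congrArg (fun e : Fin n ≃o Fin n => e i) h2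
  exact Equiv.Perm.inv_eq_iff_eq.1 h3

/-- Letters are inserted in increasing order. The ranks of the smaller letters and the counter of
`m` fix where `m` stands relative to each of them; that position and the flags update the ranks. In
the end all relative orders of letters are known. -/
theorem linearStep_injective : Function.Injective (linearStep (n := n)) := by
  intro σ τ hst
  have hP : ∀ m, (bottom σ m).card = (bottom τ m).card := fun m => by
    have := congrArg (fun s => (s m).1.toNat) hst
    simpa only [linearStep, toNat_decide_nonempty (card_bottom_le _ m)] using this
  have hS : ∀ m, (below σ m).card = (below τ m).card := fun m => by
    have := congrArg (fun s => (s m).2.1.toNat) hst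
    simpa only [linearStep, toNat_decide_nonempty (card_below_le _ m)] using this
  have hc : ∀ m, leftAt σ m = leftAt τ m := fun m => congrArg (fun s => (s m).2.2.1) hst
  have hrank : ∀ k ≤ n, ∀ x : Fin n, (x : ℕ) < k → rankAt σ k x = rankAt τ k x := by
    intro k
    induction k with
    | zero => intro _ x hx; omega
    | succ k ih =>
      intro hk x hx
      obtain ⟨m, rfl⟩ : ∃ m : Fin n, (m : ℕ) = k := ⟨⟨k, hk⟩, rfl⟩
      rcases eq_or_ne x m with rfl | hne
      · rw [rankAt_succ_eq, rankAt_succ_eq, ← leftAt_eq, ← leftAt_eq, hc, hP]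
        simp
      · have hlt : x < m := by omega
        have h1 := ih (by omega) x hlt
        have h2 : σ⁻¹ m < σ⁻¹ x ↔ τ⁻¹ m < τ⁻¹ x := by
          rw [inv_lt_inv_iff_leftAt_lt_rankAt σ hlt, inv_lt_inv_iff_leftAt_lt_rankAt τ hlt, h1, hc]
        have h3 : ∀ ρ : Equiv.Perm (Fin n), ρ⁻¹ m ≤ ρ⁻¹ x ↔ ρ⁻¹ m < ρ⁻¹ x := fun ρ =>
          ⟨fun h => lt_of_le_of_ne h fun h => hne (ρ⁻¹.injective h).symm, le_of_lt⟩
        rw [rankAt_eq, rankAt_eq] at h1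
        rw [rankAt_succ_eq, rankAt_succ_eq]
        simp only [h3, h2, hP, hS] at h1 ⊢
        omega
  refine eq_of_inv_lt_inv_iff fun x m hx => ?_
  rw [inv_lt_inv_iff_leftAt_lt_rankAt σ hx, inv_lt_inv_iff_leftAt_lt_rankAt τ hx,
    hrank m m.is_lt.le x hx, hc]

end Linear

/-! ### The generating functions -/

variable {n : ℕ}

theorem sum_cycle {R : Type*} [CommRing R] (n : ℕ) (p q a d v : R) :
    ∑ σ : Equiv.Perm (Fin n), p ^ nest σ * q ^ cros σ *
      (a ^ (n + cdfall σ - 2 * drop σ) * d ^ cdfall σ * v ^ (drop σ - cdfall σ)) =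
    PowerSeries.coeff n (jFraction (fun h => a * pqNum p q (h + 1) + d * pqNum p q h)
      fun h => v * pqNum p q h ^ 2) := by
  rw [← sum_perm_eq_coeff_jFraction cycleStep (fun σ => ⟨_, isHistory_cycleStep σ⟩)
    cycleStep_injective]
  simp only [bothCount_cycleStep, closeCount_cycleStep, ← sum_crosAt, ← sum_nestAt]
  rfl

theorem sum_linear {R : Type*} [CommRing R] (n : ℕ) (p q a d v : R) :
    ∑ σ : Equiv.Perm (Fin n), p ^ pat2_31 σ * q ^ pat31_2 σ *
      (a ^ (n + dd σ - 2 * des σ) * d ^ dd σ * v ^ (des σ - dd σ)) =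
    PowerSeries.coeff n (jFraction (fun h => a * pqNum p q (h + 1) + d * pqNum p q h)
      fun h => v * pqNum p q h ^ 2) := by
  rw [← sum_perm_eq_coeff_jFraction linearStep (fun σ => ⟨_, isHistory_linearStep σ⟩)
    linearStep_injective]
  simp only [bothCount_linearStep, closeCount_linearStep, ← sum_leftAt, ← sum_rightAt]
  rfl

theorem C_pqNumber (h : ℕ) : C (pqNumber h) = pqNum (C pVar) (C qVar) h := by
  simp [pqNumber, pqNum]

theorem drop_le_half {σ : Equiv.Perm (Fin n)} (h : cdfall σ = 0) : drop σ ≤ n / 2 := by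
  have := (isHistory_cycleStep σ).card_flags.1
  rw [closeCount_cycleStep, bothCount_cycleStep, h] at this
  omega

theorem C_hatGamma (n k : ℕ) : C (hatGamma n k) = ∑ σ ∈ hatGammaSet n k,
    (C pVar ^ nest σ * C qVar ^ (cros σ + k) : PQ[X]) := by
  simp [hatGamma]

theorem hatA_eq_sum (n : ℕ) : hatA n = ∑ k ∈ Finset.range (n / 2 + 1),
    C (hatGamma n k) * X ^ k * (1 + X) ^ (n - 2 * k) := by
  -- Setting `d = 0` keeps exactly the permutations without cycle double falls, because `0 ^ 0 = 1`.
  have h1 := sum_cycle n (C pVar : PQ[X]) (C qVar) (1 + X) 0 (X * C qVar)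
  simp only [zero_mul, add_zero, ← C_pqNumber] at h1
  have h2 : hatA n = PowerSeries.coeff n (jFraction (fun h => (1 + X) * C (pqNumber (h + 1)))
      fun h => X * C qVar * C (pqNumber h) ^ 2) := by
    simp only [hatA, C_mul, C_pow, mul_assoc]
  rw [h2, ← h1]
  have h3 : ∀ k, C (hatGamma n k) * X ^ k * (1 + X) ^ (n - 2 * k) =
      ∑ σ : Equiv.Perm (Fin n), if cdfall σ = 0 ∧ drop σ = k then
        C pVar ^ nest σ * C qVar ^ cros σ *
          ((1 + X) ^ (n - 2 * drop σ) * (X * C qVar) ^ drop σ) else 0 := by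
    intro k
    rw [C_hatGamma, Finset.sum_mul, Finset.sum_mul, ← Finset.sum_filter]
    refine Finset.sum_congr rfl fun σ hσ => ?_
    obtain ⟨-, rfl⟩ := (Finset.mem_filter.1 hσ).2
    ring
  simp only [h3]
  rw [Finset.sum_comm]
  refine Finset.sum_congr rfl fun σ _ => ?_
  by_cases h : cdfall σ = 0
  · simp [h, drop_le_half h]
  · simp [h]

theorem hatGamma_eq_sum_tildeGammaSet (n k : ℕ) :
    hatGamma n k = ∑ σ ∈ tildeGammaSet n k, pVar ^ pat2_31 σ * qVar ^ (pat31_2 σ + k) := by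
  -- Here `a = 1`, so `t` marks only drops or descents, and `v = qt` supplies the factor `q^k` along
  -- with `t^k`.
  have key := (sum_cycle n (C pVar : PQ[X]) (C qVar) 1 0 (C qVar * X)).trans
    (sum_linear n (C pVar : PQ[X]) (C qVar) 1 0 (C qVar * X)).symm
  have hterm : ∀ a b c d : ℕ, ((C pVar ^ a * C qVar ^ b *
      (1 * 0 ^ c * (C qVar * X) ^ (d - c)) : PQ[X])).coeff k =
      if c = 0 ∧ d = k then pVar ^ a * qVar ^ (b + k) else 0 := by
    intro a b c d
    by_cases hc : c = 0
    · subst hc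
      have : (C pVar ^ a * C qVar ^ b * (1 * 0 ^ 0 * (C qVar * X) ^ (d - 0)) : PQ[X]) =
          C (pVar ^ a * qVar ^ (b + d)) * X ^ d := by
        simp only [C_mul, C_pow, Nat.sub_zero]; ring
      rw [this, coeff_C_mul_X_pow]
      by_cases hd : d = k
      · subst hd; simp
      · simp [hd, Ne.symm hd]
    · simp [hc]
  have := congrArg (fun f => f.coeff k) key
  simp only [one_pow, finsetSum_coeff, hterm] at this
  rw [hatGamma, hatGammaSet, tildeGammaSet, Finset.sum_filter, Finset.sum_filter]
  exact this

theorem coeff_hatGamma_nonneg (n k : ℕ) (m : Fin 2 →₀ ℕ) : 0 ≤ (hatGamma n k).coeff m := by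
  rw [hatGamma, MvPolynomial.coeff_sum]
  refine Finset.sum_nonneg fun σ _ => ?_
  rw [pVar, qVar, MvPolynomial.X_pow_eq_monomial, MvPolynomial.X_pow_eq_monomial,
    MvPolynomial.monomial_mul, MvPolynomial.coeff_monomial]
  split_ifs <;> simp

theorem eval_hatGamma (n k : ℕ) :
    MvPolynomial.eval (fun _ => (1 : ℤ)) (hatGamma n k) = (hatGammaSet n k).card := by
  simp [hatGamma, pVar, qVar]

/-- At `p = q = 1` it counts a set that contains the identity. -/
theorem hatGamma_zero_ne_zero (n : ℕ) : hatGamma n 0 ≠ 0 := by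
  intro h
  have h1 := eval_hatGamma n 0
  rw [h, map_zero, eq_comm, Nat.cast_eq_zero, Finset.card_eq_zero] at h1
  have h2 : (1 : Equiv.Perm (Fin n)) ∈ hatGammaSet n 0 := by simp [hatGammaSet, cdfall, drop]
  rw [h1] at h2
  simp at h2

/-- The `k`-th term has degree at most `n - k`, so only `k = 0` reaches `t^n`. -/
theorem natDegree_hatA (n : ℕ) : (hatA n).natDegree = n := by
  have hX : (1 + X : PQ[X]).natDegree = 1 := by rw [add_comm]; exact natDegree_X_add_C 1
  have hm : (1 + X : PQ[X]).Monic := by rw [add_comm]; exact monic_X_add_C 1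
  have hle : ∀ k, 2 * k ≤ n →
      (C (hatGamma n k) * X ^ k * (1 + X) ^ (n - 2 * k)).natDegree ≤ n - k := by
    intro k hk
    refine (natDegree_mul_le_of_le (natDegree_C_mul_X_pow_le _ k)
      (natDegree_pow_le_of_le (n - 2 * k) hX.le)).trans ?_
    omega
  have hcoeff : (hatA n).coeff n = hatGamma n 0 := by
    rw [hatA_eq_sum, finsetSum_coeff, Finset.sum_eq_single 0]
    · have h1 := hm.pow n
      rw [Monic, leadingCoeff, hm.natDegree_pow, hX, mul_one] at h1
      rw [pow_zero, mul_one, mul_zero, Nat.sub_zero, coeff_C_mul, h1, mul_one]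
    · intro k hk h0
      rw [Finset.mem_range] at hk
      refine coeff_eq_zero_of_natDegree_lt ((hle k (by omega)).trans_lt (by omega))
    · simp
  refine le_antisymm ?_ (le_natDegree_of_ne_zero (by rw [hcoeff]; exact hatGamma_zero_ne_zero n))
  rw [hatA_eq_sum]
  refine natDegree_sum_le_of_forall_le _ _ fun k hk => ?_
  rw [Finset.mem_range] at hk
  exact (hle k (by omega)).trans (by omega)

/-! ### The specialization `p = q = 1` -/

theorem pqNum_one (h : ℕ) : pqNum (1 : ℤ[X]) 1 h = h := by simp [pqNum]

/-- Complementing the values exchanges ascents and descents at the `m` adjacent pairs. -/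
theorem des_mul_revPerm (m : ℕ) (σ : Equiv.Perm (Fin (m + 1))) :
    des (Fin.revPerm * σ) + des σ = m := by
  rw [des, des, ← Finset.card_union_of_disjoint, ← Finset.filter_or]
  · have : (Finset.univ.filter fun i : Fin (m + 1) =>
        (∃ j : Fin (m + 1), (j : ℕ) = i + 1 ∧ (Fin.revPerm * σ : Equiv.Perm (Fin (m + 1))) i >
          (Fin.revPerm * σ : Equiv.Perm (Fin (m + 1))) j) ∨
        ∃ j : Fin (m + 1), (j : ℕ) = i + 1 ∧ σ i > σ j) = Finset.univ.erase (Fin.last m) := by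
      ext i
      simp only [Finset.mem_filter, Finset.mem_univ, true_and, Finset.mem_erase, and_true,
        Equiv.Perm.mul_apply, Fin.revPerm_apply, gt_iff_lt, Fin.rev_lt_rev]
      constructor
      · rintro (⟨j, hj, -⟩ | ⟨j, hj, -⟩) rfl <;> simp at hj <;> omega
      · intro hi
        have hi' : (i : ℕ) + 1 < m + 1 := by
          have := Fin.val_ne_of_ne hi
          simp at this
          omega
        have hne : σ i ≠ σ ⟨i + 1, hi'⟩ := fun h => by
          have := congrArg Fin.val (σ.injective h)
          simp at this
        rcases lt_or_gt_of_ne hne with h | h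
        · exact Or.inl ⟨_, rfl, h⟩
        · exact Or.inr ⟨_, rfl, h⟩
    rw [this, Finset.card_erase_of_mem (Finset.mem_univ _)]
    simp
  · rw [Finset.disjoint_filter]
    rintro i - ⟨j, hj, h⟩ ⟨j', hj', h'⟩
    obtain rfl : j = j' := by omega
    simp only [Equiv.Perm.mul_apply, Fin.revPerm_apply, gt_iff_lt, Fin.rev_lt_rev] at h
    exact lt_asymm h h'

/-- The size must be positive: for the empty permutation the left side is `1`, which becomes the
isolated `1` of the binomial-Eulerian polynomial. -/
theorem sum_X_pow_sub_des (m : ℕ) :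
    ∑ σ : Equiv.Perm (Fin (m + 1)), (X : ℤ[X]) ^ (m + 1 - des σ) = X * eulerian (m + 1) := by
  rw [eulerian, Finset.mul_sum,
    ← Equiv.sum_comp (Equiv.mulLeft (Fin.revPerm : Equiv.Perm (Fin (m + 1))))
      fun σ => X * (X : ℤ[X]) ^ des σ]
  refine Finset.sum_congr rfl fun σ _ => ?_
  have := des_mul_revPerm m σ
  rw [Equiv.coe_mulLeft, ← pow_succ']
  simp only
  congr 1
  omega

theorem sum_X_pow_sub_des_eq_historySum (n : ℕ) :
    ∑ σ : Equiv.Perm (Fin n), (X : ℤ[X]) ^ (n - des σ) =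
      historySum (stepWeight (1 : ℤ[X]) 1 X 1 X) n 0 := by
  have h1 := (isMotzkin_historySum (1 : ℤ[X]) 1 X 1 X).coeff_jFraction n
  simp only [mul_assoc X, ← sq] at h1
  rw [← h1, ← sum_linear]
  refine Finset.sum_congr rfl fun σ _ => ?_
  have h2 := (isHistory_linearStep σ).card_flags
  rw [closeCount_linearStep, bothCount_linearStep] at h2
  rw [one_pow, one_pow, one_pow, mul_one, one_mul, mul_one, ← pow_add]
  congr 1
  omega

theorem specializeOne_hatA (n : ℕ) : specializeOne (hatA n) = binomialEulerian n := by
  have hA : IsMotzkin (fun h => X * C qVar * pqNum (C pVar : PQ[X]) (C qVar) h)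
      (fun h => (1 + X) * pqNum (C pVar : PQ[X]) (C qVar) (h + 1) +
        0 * pqNum (C pVar : PQ[X]) (C qVar) h) _ _ :=
    isMotzkin_historySum (C pVar : PQ[X]) (C qVar) (1 + X) 0 (X * C qVar)
  have h1 : hatA n =
      historySum (stepWeight (C pVar : PQ[X]) (C qVar) (1 + X) 0 (X * C qVar)) n 0 := by
    rw [← hA.coeff_jFraction, hatA]
    simp only [C_mul, C_pqNumber, zero_mul, add_zero, mul_assoc, sq]
  have h2 := hA.map (mapRingHom (MvPolynomial.eval fun _ => (1 : ℤ)))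
  have h3 := (isMotzkin_historySum (1 : ℤ[X]) 1 X 1 X).binomial
  have hnum : ∀ h, mapRingHom (MvPolynomial.eval fun _ => (1 : ℤ))
      (pqNum (C pVar : PQ[X]) (C qVar) h) = (h : ℤ[X]) := by
    intro h; simp [pqNum, pVar, qVar]
  have h4 : specializeOne (hatA n) = ∑ m ∈ Finset.range (n + 1), (n.choose m : ℤ[X]) *
      historySum (stepWeight (1 : ℤ[X]) 1 X 1 X) m 0 := by
    rw [h1]
    refine h2.unique (Q := fun n h => ∑ m ∈ Finset.range (n + 1), (n.choose m : ℤ[X]) *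
      historySum (stepWeight (1 : ℤ[X]) 1 X 1 X) m h) ?_ n 0
    -- Both arrays are Motzkin arrays with equal weights; for the level weights this is `(1 + t)(h +
    -- 1) = 1 + (t(h + 1) + h)`.
    convert h3 using 1
    · funext h
      simp only [map_mul, hnum, pqNum_one]
      simp [qVar]
    · funext h
      simp only [map_mul, map_add, hnum, pqNum_one]
      simp
      ring
    · funext h
      simp only [hnum, pqNum_one]
  have h5 : Finset.Icc 1 n = Finset.Ico 1 (n + 1) := by ext; simp
  rw [h4, binomialEulerian, h5, Finset.sum_Ico_eq_sum_range, Finset.sum_range_succ', add_comm,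
    Finset.mul_sum]
  congr 1
  · simp [historySum, histories]
  · refine Finset.sum_congr (by simp) fun m _ => ?_
    rw [← sum_X_pow_sub_des_eq_historySum, sum_X_pow_sub_des, add_comm 1 m]
    ring

end BinomialEulerian

theorem mainTheorem7 (n : ℕ) :
    specializeOne (hatA n) = binomialEulerian n ∧
    (hatA n).natDegree = n ∧
    hatA n = ∑ k ∈ Finset.range (n / 2 + 1),
      C (hatGamma n k) * X ^ k * (1 + X) ^ (n - 2 * k) ∧
    (∀ k ≤ n / 2,
      (∀ m, 0 ≤ (hatGamma n k).coeff m) ∧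
      hatGamma n k = ∑ σ ∈ tildeGammaSet n k, pVar ^ pat2_31 σ * qVar ^ (pat31_2 σ + k)) :=
  ⟨specializeOne_hatA n, natDegree_hatA n, hatA_eq_sum n, fun k _ =>
    ⟨coeff_hatGamma_nonneg n k, hatGamma_eq_sum_tildeGammaSet n k⟩⟩
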